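/- A vertex operator algebra (VOA) $V$ is here a VOA over $\mathbf{C}$ of central charge $c$ with vacuum $\mathbf 1$ and Virasoro vector $\omega$, $Y(v,z)=\sum_{n\in\mathbf Z}v_{(n)}z^{-n-1}$, $L_n=\omega_{(n+1)}$, and $V=\bigoplus_{n\ge 0}V_n$, where the $V_n=\{v: L_0v=nv\}$ are finite-dimensional and $V_0=\mathbf{C}\mathbf 1$. For $v\in V_n$ put $o(v)=v_{(n-1)}$; it maps each homogeneous subspace of a $V$-module to itself. Assume that $V$ is a direct sum of highest weight modules for the Virasoro algebra $(L_n)$ (quotients of Verma modules $M(c,h')$, $h'\in\mathbf Z_{\ge 0}$), fix such a decomposition, let $\overline M(h')$ be the sum of the summands of highest weight $h'$, and let $\pi:V\to V_\omega=\overline M(0)$ be the projection with kernel $\bigoplus_{h'>0}\overline M(h')$. A Virasoro highest weight vector of weight $s$ is a nonzero $v\in V_s$ with $L_nv=0$ for all $n\ge 1$. For a positive integer $t$, a homogeneous subspace $X$ of a $V$-module is a conformal $t$-design based on $V$ if $\mathrm{tr}|_X\,o(v)=\mathrm{tr}|_X\,o(\pi(v))$ for all $v\in V_n$ with $0\le n\le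 t$. **Theorem.** Let $N$ be an (ordinary) $V$-module graded by $\mathbf Z+h$, with homogeneous subspaces $N_n$ (the $L_0$-eigenspaces of eigenvalue $n$, finite-dimensional, and zero for $n$ sufficiently small), and let $t$ be a positive integer. Here $n\le h$ means $n\in h-\mathbf Z_{\ge 0}$. 1. The following are equivalent: (i) the subspaces $N_n$ are conformal $t$-designs based on $V$ for all $n\le h$; (ii$'$) $\mathrm{tr}|_{N_n}\,o(v)=0$ for all $n\le h$ and all Virasoro highest weight vectors $v\in V_s$ with $0<s\le t$ and $\pi(v)=0$. 2. Suppose that $V_\omega$ contains no Virasoro highest weight vector of weight $s$ with $0<s\le t$ (for example, that $V_\omega$ is simple). Then (i) is equivalent to: (ii) $\mathrm{tr}|_{N_n}\,o(v)=0$ for all $n\le h$ and all Virasoro highest weight vectors $v\in V_s$ with $0<s\le t$. -/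

import Mathlib

/-! ## Vertex operator algebras, their modules and conformal designs -/

noncomputable section

namespace VOA

/-- The mode `v_(n)` of a field map `Y`, i.e. the coefficient of `z ^ (-n-1)` in `Y(v, z)`. -/
def mode {V N : Type*} [AddCommGroup V] [Module ℂ V] [AddCommGroup N] [Module ℂ N]
    (Y : V →ₗ[ℂ] VertexOperator ℂ N) (v : V) (n : ℤ) : N →ₗ[ℂ] N :=
  VertexOperator.ncoeff (Y v) n

/-- The Jacobi identity in components (the Borcherds identity), for the field map `Y` of `V` and a
field map `Z` of `V` on `N`:
`∑ᵢ (m choose i) (u_(l+i) v)_(m+n-i) =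
  ∑ᵢ (-1)ⁱ (l choose i) (u_(l+m-i) v_(n+i) - (-1)ˡ v_(l+n-i) u_(m+i))` on `N`.
All sums are finite, since the values of a `VertexOperator` are Laurent series. -/
def JacobiIdentity {V N : Type*} [AddCommGroup V] [Module ℂ V] [AddCommGroup N] [Module ℂ N]
    (Y : V →ₗ[ℂ] VertexOperator ℂ V) (Z : V →ₗ[ℂ] VertexOperator ℂ N) : Prop :=
  ∀ (u v : V) (w : N) (l m n : ℤ),
    (∑ᶠ i : ℕ, Ring.choose m i • mode Z (mode Y u (l + i) v) (m + n - i) w) =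
      ∑ᶠ i : ℕ, ((-1 : ℤ) ^ i * Ring.choose l i) •
        (mode Z u (l + m - i) (mode Z v (n + i) w) -
          (-1 : ℂ) ^ l • mode Z v (l + n - i) (mode Z u (m + i) w))

end VOA

/-- A vertex operator algebra over `ℂ` with `V_n = 0` for `n < 0` and `V_0 = ℂ 𝟙`. The operators
`L_n` are the modes `ω_(n+1)`, and `V_n` is the eigenspace of `L_0` for the eigenvalue `n`. -/
class VertexOperatorAlgebra (V : Type*) [AddCommGroup V] [Module ℂ V] where
  /-- The state-field map `v ↦ Y(v, z)`. -/
  Y : V →ₗ[ℂ] VertexOperator ℂ V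
  /-- The vacuum vector `𝟙`. -/
  vacuum : V
  /-- The Virasoro vector `ω`. -/
  omega : V
  /-- The central charge `c`. -/
  centralCharge : ℂ
  vacuum_ne_zero : vacuum ≠ 0
  omega_ne_zero : omega ≠ 0
  /-- `Y(𝟙, z) = id`. -/
  vacuum_mode : ∀ (n : ℤ) (v : V), VOA.mode Y vacuum n v = if n = -1 then v else 0
  /-- `Y(v, z) 𝟙` has no pole and has constant term `v`. -/
  mode_vacuum : ∀ (v : V) (n : ℤ), 0 ≤ n → VOA.mode Y v n vacuum = 0
  creation : ∀ v : V, VOA.mode Y v (-1) vacuum = v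
  jacobi : VOA.JacobiIdentity Y Y
  /-- `[L_m, L_n] = (m - n) L_{m+n} + (m³ - m)/12 δ_{m+n,0} c`. -/
  virasoro : ∀ (m n : ℤ) (v : V),
    VOA.mode Y omega (m + 1) (VOA.mode Y omega (n + 1) v) -
        VOA.mode Y omega (n + 1) (VOA.mode Y omega (m + 1) v) =
      ((m : ℂ) - n) • VOA.mode Y omega (m + n + 1) v +
        (if m + n = 0 then ((m : ℂ) ^ 3 - m) / 12 * centralCharge else 0) • v
  /-- `Y(L_{-1} v, z) = d/dz Y(v, z)`. -/
  derivative : ∀ (v : V) (n : ℤ),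
    VOA.mode Y (VOA.mode Y omega 0 v) n = (-n : ℂ) • VOA.mode Y v (n - 1)
  /-- `V` is the sum (automatically direct) of the eigenspaces `V_n` of `L_0`. -/
  iSup_weight : ⨆ n : ℤ, Module.End.eigenspace (VOA.mode Y omega 1) (n : ℂ) = ⊤
  finite_weight : ∀ n : ℤ,
    FiniteDimensional ℂ (Module.End.eigenspace (VOA.mode Y omega 1) (n : ℂ))
  weight_neg : ∀ n : ℤ, n < 0 → Module.End.eigenspace (VOA.mode Y omega 1) (n : ℂ) = ⊥
  weight_zero : Module.End.eigenspace (VOA.mode Y omega 1) 0 = Submodule.span ℂ {vacuum}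

/-- An (ordinary) module `N` of the vertex operator algebra `V`: the vacuum acts as the identity,
the Jacobi identity holds, and `N` is the direct sum of the eigenspaces of `L_0`, which are
finite-dimensional and, in each class modulo `ℤ`, vanish for all sufficiently small eigenvalues. -/
class VOAModule (V N : Type*) [AddCommGroup V] [Module ℂ V] [AddCommGroup N] [Module ℂ N]
    [VertexOperatorAlgebra V] where
  /-- The field map `v ↦ Y_N(v, z)`. -/
  Y : V →ₗ[ℂ] VertexOperator ℂ N
  vacuum_mode : ∀ (n : ℤ) (w : N),
    VOA.mode Y (VertexOperatorAlgebra.vacuum : V) n w = if n = -1 then w else 0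
  jacobi : VOA.JacobiIdentity VertexOperatorAlgebra.Y Y
  /-- `N` is the sum (automatically direct) of the eigenspaces of `L_0`. -/
  iSup_weight : ⨆ a : ℂ,
    Module.End.eigenspace (VOA.mode Y (VertexOperatorAlgebra.omega : V) 1) a = ⊤
  finite_weight : ∀ a : ℂ, FiniteDimensional ℂ
    (Module.End.eigenspace (VOA.mode Y (VertexOperatorAlgebra.omega : V) 1) a)
  lower_bound : ∀ a : ℂ, ∃ K : ℤ, ∀ k : ℤ, k < K →
    Module.End.eigenspace (VOA.mode Y (VertexOperatorAlgebra.omega : V) 1) (a + k) = ⊥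

namespace VOA

open VertexOperatorAlgebra

section Algebra

variable {V : Type*} [AddCommGroup V] [Module ℂ V] [VertexOperatorAlgebra V]

/-- The Virasoro operator `L_n = ω_(n+1)` on `V`. -/
def L (n : ℤ) : V →ₗ[ℂ] V := mode Y (omega : V) (n + 1)

variable (V) in
/-- The homogeneous subspace `V_n`. -/
def weightSpace (n : ℤ) : Submodule ℂ V := Module.End.eigenspace (L 0 : V →ₗ[ℂ] V) (n : ℂ)

/-- `v` is a Virasoro highest weight vector (singular vector) of weight `s`. -/
structure IsHighestWeightVector (v : V) (s : ℤ) : Prop where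
  ne_zero : v ≠ 0
  mem : v ∈ weightSpace V s
  annihilated : ∀ n : ℤ, 1 ≤ n → L n v = 0

/-- The Virasoro submodule of `V` generated by `v`. For a highest weight vector `v` of weight `s`
this is a highest weight module, i.e. a quotient of the Verma module `M(c, s)`. -/
def virasoroSpan (v : V) : Submodule ℂ V :=
  sInf {W | v ∈ W ∧ ∀ n : ℤ, ∀ w ∈ W, L n w ∈ W}

theorem L_mem_virasoroSpan (v : V) (n : ℤ) {w : V} (hw : w ∈ virasoroSpan v) :
    L n w ∈ virasoroSpan v := by
  rw [virasoroSpan, Submodule.mem_sInf] at *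
  exact fun W hW => hW.2 n w (hw W hW)

end Algebra

/-- A decomposition of `V` into an (internal) direct sum of highest weight modules for the Virasoro
algebra, with highest weights in `ℕ`. -/
structure VirasoroDecomposition (V : Type*) [AddCommGroup V] [Module ℂ V]
    [VertexOperatorAlgebra V] (ι : Type*) where
  /-- The highest weight vector generating the `i`-th summand. -/
  gen : ι → V
  /-- The weight of the `i`-th generator. -/
  wt : ι → ℕ
  highestWeight : ∀ i, IsHighestWeightVector (gen i) (wt i)
  independent : iSupIndep fun i => virasoroSpan (gen i)
  iSup_eq_top : ⨆ i, virasoroSpan (gen i) = ⊤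

namespace VirasoroDecomposition

variable {V : Type*} [AddCommGroup V] [Module ℂ V] [VertexOperatorAlgebra V] {ι : Type*}
  (D : VirasoroDecomposition V ι)

/-- `M̄(h)`, the sum of the highest weight modules of highest weight `h`. For `h = 0` this is the
subalgebra `V_ω` generated by `ω`. -/
def Mbar (h : ℕ) : Submodule ℂ V := ⨆ i, ⨆ (_ : D.wt i = h), virasoroSpan (D.gen i)

/-- The direct sum of the `M̄(h)` with `h > 0`. -/
def positivePart : Submodule ℂ V := ⨆ h : ℕ, ⨆ (_ : 0 < h), D.Mbar h

theorem positivePart_eq :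
    D.positivePart = ⨆ i ∈ {i | 0 < D.wt i}, virasoroSpan (D.gen i) := by
  apply le_antisymm
  · refine iSup₂_le fun h hh => iSup₂_le fun i hi => ?_
    exact le_iSup₂_of_le (f := fun i (_ : i ∈ {i | 0 < D.wt i}) => virasoroSpan (D.gen i)) i
      (by simpa [hi] using hh) le_rfl
  · refine iSup₂_le fun i hi => ?_
    refine le_iSup₂_of_le (D.wt i) hi ?_
    exact le_iSup₂_of_le (f := fun j (_ : D.wt j = D.wt i) => virasoroSpan (D.gen j)) i rfl le_rfl

theorem isCompl : IsCompl (D.Mbar 0) D.positivePart := by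
  rw [positivePart_eq]
  constructor
  · refine D.independent.disjoint_biSup_biSup (s := {i | D.wt i = 0}) (t := {i | 0 < D.wt i}) ?_
    rw [Set.disjoint_left]
    intro i hi hi'
    simp_all
  · rw [codisjoint_iff, eq_top_iff, ← D.iSup_eq_top]
    refine iSup_le fun i => ?_
    rcases Nat.eq_zero_or_pos (D.wt i) with hi | hi
    · exact le_sup_of_le_left
        (le_iSup₂_of_le (f := fun j (_ : D.wt j = 0) => virasoroSpan (D.gen j)) i hi le_rfl)
    · exact le_sup_of_le_right
        (le_iSup₂_of_le (f := fun j (_ : j ∈ {i | 0 < D.wt i}) => virasoroSpan (D.gen j))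
          i hi le_rfl)

/-- The projection `π` of `V` onto `V_ω = M̄(0)` with kernel the direct sum of the `M̄(h)`,
`h > 0`. -/
def proj : V →ₗ[ℂ] V := Submodule.projection _ _ D.isCompl

theorem L_mem_iSup (S : Set ι) (n : ℤ) {w : V} (hw : w ∈ ⨆ i ∈ S, virasoroSpan (D.gen i)) :
    L n w ∈ ⨆ i ∈ S, virasoroSpan (D.gen i) := by
  suffices (⨆ i ∈ S, virasoroSpan (D.gen i)) ≤
      (⨆ i ∈ S, virasoroSpan (D.gen i)).comap (L n) from this hw
  refine iSup₂_le fun i hi x hx => ?_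
  exact (le_iSup₂_of_le (f := fun j (_ : j ∈ S) => virasoroSpan (D.gen j)) i hi le_rfl)
    (L_mem_virasoroSpan _ n hx)

/-- `π` preserves degrees. -/
theorem proj_mem {n : ℤ} {v : V} (hv : v ∈ weightSpace V n) : D.proj v ∈ weightSpace V n := by
  have hL : ∀ x ∈ D.Mbar 0, L 0 x ∈ D.Mbar 0 :=
    fun x hx => D.L_mem_iSup {i | D.wt i = 0} 0 hx
  have hL' : ∀ x ∈ D.positivePart, L 0 x ∈ D.positivePart := by
    rw [positivePart_eq]
    exact fun x hx => D.L_mem_iSup _ 0 hx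
  rw [weightSpace, Module.End.mem_eigenspace_iff] at hv ⊢
  have h0 : D.proj v ∈ D.Mbar 0 := Submodule.projection_apply_mem _ v
  have h1 : v - D.proj v ∈ D.positivePart := by
    have : D.proj (v - D.proj v) = 0 := by
      rw [map_sub, sub_eq_zero]
      exact ((Submodule.projection_eq_self_iff D.isCompl _).2 h0).symm
    exact (Submodule.projection_apply_eq_zero_iff D.isCompl).1 this
  have h2 : L 0 (D.proj v) - (n : ℂ) • D.proj v ∈ D.Mbar 0 :=
    sub_mem (hL _ h0) (Submodule.smul_mem _ _ h0)
  have h3 : L 0 (D.proj v) - (n : ℂ) • D.proj v ∈ D.positivePart := by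
    have h4 : L 0 (v - D.proj v) - (n : ℂ) • (v - D.proj v) ∈ D.positivePart :=
      sub_mem (hL' _ h1) (Submodule.smul_mem _ _ h1)
    rw [map_sub, hv, smul_sub] at h4
    rw [← neg_mem_iff]
    convert h4 using 1
    abel
  exact sub_eq_zero.1 (Submodule.disjoint_def.1 D.isCompl.disjoint _ h2 h3)

end VirasoroDecomposition

section Modules

variable {V : Type*} (N : Type*) [AddCommGroup V] [Module ℂ V] [AddCommGroup N] [Module ℂ N]
  [VertexOperatorAlgebra V] [VOAModule V N]

variable (V) in
/-- The homogeneous subspace `N_a` of a module: the eigenspace of `L_0` for the eigenvalue `a`. -/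
def moduleWeightSpace (a : ℂ) : Submodule ℂ N :=
  Module.End.eigenspace (mode (VOAModule.Y : V →ₗ[ℂ] VertexOperator ℂ N) omega 1) a

variable (V) in
/-- The module `N` is graded by `ℤ + h`. -/
def IsGradedBy (h : ℂ) : Prop :=
  ∀ a : ℂ, moduleWeightSpace V N a ≠ ⊥ → ∃ k : ℤ, a = h + k

variable {N} in
/-- `(v_(-2) 𝟙)_(n) = -n v_(n-1)` on a module. -/
theorem mode_mode_vacuum (v : V) (n : ℤ) (w : N) :
    mode (VOAModule.Y : V →ₗ[ℂ] VertexOperator ℂ N) (mode Y v (-2) vacuum) n w =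
      (-n : ℂ) • mode (VOAModule.Y : V →ₗ[ℂ] VertexOperator ℂ N) v (n - 1) w := by
  have h := VOAModule.jacobi (V := V) (N := N) v vacuum w (-2) 0 n
  rw [finsum_eq_single _ 0] at h
  swap
  · intro i hi
    simp [Ring.choose_zero_pos ℤ (Nat.pos_of_ne_zero hi)]
  have hc : ∀ i : ℕ, (-1 : ℤ) ^ i * Ring.choose (-2 : ℤ) i = i + 1 := by
    intro i
    have h1 : Ring.choose ((2 : ℤ) + i - 1) i = i + 1 := by
      have := Ring.multichoose_eq (2 : ℤ) i
      rw [← this, Ring.multichoose_two]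
    rw [Ring.choose_neg, h1, Int.negOnePow_def, Units.smul_def]
    have h2 : (-1 : ℤ) ^ i * (-1 : ℤ) ^ i = 1 := by rw [← mul_pow]; simp
    simp only [zpow_natCast, Units.val_pow_eq_pow_val, Units.val_neg, Units.val_one, smul_eq_mul]
    rw [← mul_assoc, h2, one_mul]
  simp only [hc, VOAModule.vacuum_mode] at h
  have e : ((-1 : ℂ) ^ (-2 : ℤ)) = 1 := by norm_num [zpow_neg]
  simp only [Nat.cast_zero, Ring.choose_zero_right, add_zero, zero_add, sub_zero, one_smul, e] at h
  rw [h]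
  rcases lt_trichotomy n 0 with hn | hn | hn
  · obtain ⟨j, rfl⟩ : ∃ j : ℕ, n = -1 - j := ⟨(-1 - n).toNat, by omega⟩
    rw [finsum_eq_single _ j]
    · rw [if_pos (by omega), if_neg (by omega), sub_zero, ← Int.cast_smul_eq_zsmul ℂ,
        show (-2 - (j : ℤ)) = -1 - j - 1 by ring]
      push_cast
      congr 1
      ring
    · intro i hi
      rw [if_neg (by omega), if_neg (by omega)]
      simp
  · subst hn
    rw [finsum_eq_zero_of_forall_eq_zero]
    · simp
    · intro i
      rw [if_neg (by omega), if_neg (by omega)]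
      simp
  · obtain ⟨j, rfl⟩ : ∃ j : ℕ, n = 1 + j := ⟨(n - 1).toNat, by omega⟩
    rw [finsum_eq_single _ j]
    · rw [if_neg (by omega), if_pos (by omega), map_zero, zero_sub, smul_neg,
        ← Int.cast_smul_eq_zsmul ℂ, add_sub_cancel_left, ← neg_smul]
      push_cast
      congr 1
      ring
    · intro i hi
      rw [if_neg (by omega), if_neg (by omega)]
      simp

variable {N} in
/-- `[L_0, v_(n)] = (L_{-1} v)_(n+1) + (L_0 v)_(n)` on a module. -/
theorem commutator_L_zero (v : V) (n : ℤ) (w : N) :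
    mode (VOAModule.Y : V →ₗ[ℂ] VertexOperator ℂ N) (L (-1) v) (n + 1) w +
        mode (VOAModule.Y : V →ₗ[ℂ] VertexOperator ℂ N) (L 0 v) n w =
      mode (VOAModule.Y : V →ₗ[ℂ] VertexOperator ℂ N) omega 1
          (mode (VOAModule.Y : V →ₗ[ℂ] VertexOperator ℂ N) v n w) -
        mode (VOAModule.Y : V →ₗ[ℂ] VertexOperator ℂ N) v n
          (mode (VOAModule.Y : V →ₗ[ℂ] VertexOperator ℂ N) omega 1 w) := by
  have h := VOAModule.jacobi (V := V) (N := N) omega v w 0 1 n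
  rw [finsum_eq_sum_of_support_subset (s := Finset.range 2), finsum_eq_single _ 0] at h
  · simpa [Finset.sum_range_succ, L, add_comm] using h
  · intro i hi
    simp [Ring.choose_zero_pos ℤ (Nat.pos_of_ne_zero hi)]
  · intro i hi
    by_contra hi'
    apply hi
    have : Ring.choose (1 : ℤ) i = 0 := by
      have := Ring.choose_natCast (R := ℤ) 1 i
      rw [Nat.choose_eq_zero_of_lt (by simpa using hi')] at this
      simpa using this
    simp [this]

theorem L_neg_one_eq (v : V) : L (-1) v = mode Y v (-2) vacuum := by
  have h := congrArg (fun f => f vacuum) (derivative v (-1))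
  simpa [creation, L] using h

/-- For `v ∈ V_n` the operator `o(v) = v_(n-1)` maps each homogeneous subspace to itself. -/
theorem mapsTo_zeroMode {v : V} {n : ℤ} (hv : v ∈ weightSpace V n) (a : ℂ) :
    ∀ w ∈ moduleWeightSpace V N a,
      mode (VOAModule.Y : V →ₗ[ℂ] VertexOperator ℂ N) v (n - 1) w ∈ moduleWeightSpace V N a := by
  intro w hw
  rw [moduleWeightSpace, Module.End.mem_eigenspace_iff] at hw ⊢
  rw [weightSpace, Module.End.mem_eigenspace_iff] at hv
  have h := commutator_L_zero v (n - 1) w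
  rw [L_neg_one_eq, mode_mode_vacuum, hv, hw, eq_sub_iff_add_eq] at h
  have h2 : mode (VOAModule.Y : V →ₗ[ℂ] VertexOperator ℂ N) ((n : ℂ) • v) (n - 1) w =
      (n : ℂ) • mode (VOAModule.Y : V →ₗ[ℂ] VertexOperator ℂ N) v (n - 1) w := by
    simp [mode]
  rw [h2] at h
  rw [← h]
  simp

/-- The trace `tr|_{N_a} o(v)` for `v ∈ V_n`, where `o(v) = v_(n-1)`. -/
def traceZeroMode (v : V) (n : ℤ) (hv : v ∈ weightSpace V n) (a : ℂ) : ℂ :=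
  LinearMap.trace ℂ (moduleWeightSpace V N a)
    ((mode (VOAModule.Y : V →ₗ[ℂ] VertexOperator ℂ N) v (n - 1)).restrict
      (mapsTo_zeroMode N hv a))

/-- The degree `a` subspace `N_a` is a conformal `t`-design based on `V`:
`tr|_{N_a} o(v) = tr|_{N_a} o(π(v))` for all `v ∈ V_n` with `0 ≤ n ≤ t`. -/
def IsConformalDesign {ι : Type*} (D : VirasoroDecomposition V ι) (t : ℕ) (a : ℂ) : Prop :=
  ∀ n : ℤ, 0 ≤ n → n ≤ t → ∀ (v : V) (hv : v ∈ weightSpace V n),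
    traceZeroMode N v n hv a = traceZeroMode N (D.proj v) n (D.proj_mem hv) a

end Modules

end VOA

end

/-! The point is that vanishing of traces passes from a highest weight vector to all its Virasoro
descendants. Let `u` have weight `n`. On a fixed `N_a` the associativity formula writes `o(L_{-m}
u)` as a finite combination of products `L_k u_(n-1-k)` and `u_(n-1-k) L_k`. The commutator of the
two factors is a combination of `o(L_{i-1} u)`, `i ≥ 0`. Since `o(L_{-1} u) = -n o(u)`, this
involves only weights at most `n`, whose traces vanish by induction on the weight. Hence both orders
of the product have the same trace on each `N_b` with `b` in `a - ℕ`. Cyclicity equates the trace of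
one order on `N_b` with that of the other on `N_{b+k}`. So for `k ≠ 0` the trace is unchanged when
the degree drops by `|k|`, and it is zero because `N` vanishes in low degrees; for `k = 0`, `L_0` is
a scalar. This descent is why the conditions are imposed in all degrees `≤ h` together
(`gradedTrace_moduleL_mul_eq_zero`, `traceFunctional_L_neg_eq_zero`).

For `v` of weight `n ≤ t`, `v - π(v)` is a sum of descendants of generators of positive weight at
most `t`, which gives the first equivalence. For the second, `π` commutes with the Virasoro action,
so it sends a highest weight vector to zero or to one in `V_ω`. -/

noncomputable section

/-! ## Traces of compressions to a subspace -/

/-- The trace of the compression of an endomorphism to a subspace `U`, along a fixed linear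
projection onto `U`. -/
def Submodule.compressionTrace {K M : Type*} [Field K] [AddCommGroup M] [Module K M]
    (U : Submodule K M) : Module.End K M →ₗ[K] K where
  toFun f := LinearMap.trace K U (LinearMap.leftInverse U.subtype ∘ₗ f ∘ₗ U.subtype)
  map_add' f g := by rw [LinearMap.add_comp, LinearMap.comp_add, map_add]
  map_smul' c f := by rw [LinearMap.smul_comp, LinearMap.comp_smul, map_smul]; rfl

namespace Submodule

variable {K M : Type*} [Field K] [AddCommGroup M] [Module K M] {U W : Submodule K M}

theorem leftInverse_subtype_coe (x : U) : LinearMap.leftInverse U.subtype (x : M) = x :=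
  LinearMap.leftInverse_apply_of_inj U.ker_subtype x

theorem compressionTrace_congr {f g : Module.End K M} (h : ∀ w ∈ U, f w = g w) :
    U.compressionTrace f = U.compressionTrace g := by
  have : f ∘ₗ U.subtype = g ∘ₗ U.subtype := LinearMap.ext fun x => h x x.2
  simp only [compressionTrace, LinearMap.coe_mk, AddHom.coe_mk, this]

theorem compressionTrace_eq_trace_restrict {f : Module.End K M} (h : ∀ w ∈ U, f w ∈ U) :
    U.compressionTrace f = LinearMap.trace K U (f.restrict h) := by
  simp only [compressionTrace, LinearMap.coe_mk, AddHom.coe_mk]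
  congr 1
  ext x
  exact congrArg Subtype.val (leftInverse_subtype_coe (⟨f x, h x x.2⟩ : U))

theorem compressionTrace_bot (f : Module.End K M) :
    (⊥ : Submodule K M).compressionTrace f = 0 := by
  rw [compressionTrace_congr (g := 0), map_zero]
  rintro w hw
  rw [(mem_bot K).1 hw, map_zero, map_zero]

/-- Cyclicity across two different spaces; later `U` and `W` are homogeneous subspaces of different
degrees. -/
theorem compressionTrace_mul_comm [FiniteDimensional K U] [FiniteDimensional K W]
    {f g : Module.End K M} (hf : ∀ w ∈ U, f w ∈ W) (hg : ∀ w ∈ W, g w ∈ U) :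
    U.compressionTrace (g * f) = W.compressionTrace (f * g) := by
  rw [compressionTrace_eq_trace_restrict (f := g * f) (fun w hw => hg (f w) (hf w hw)),
    compressionTrace_eq_trace_restrict (f := f * g) (fun w hw => hf (g w) (hg w hw))]
  exact LinearMap.trace_comp_comm' (f.restrict hf) (g.restrict hg)

end Submodule

/-- Used to extract homogeneous components: `A` is the weight grading and `S` a graded subspace. -/
theorem iSupIndep.mem_of_mem_iSup {K M κ : Type*} [Ring K] [AddCommGroup M] [Module K M]
    {A S : κ → Submodule K M} (hA : iSupIndep A) (hS : ∀ k, S k ≤ A k) {n : κ} {x : M}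
    (hx : x ∈ A n) (hxS : x ∈ ⨆ k, S k) : x ∈ S n := by
  have hle : ⨆ k, S k ≤ S n ⊔ ⨆ k, ⨆ (_ : k ≠ n), A k := by
    refine iSup_le fun k => ?_
    by_cases hk : k = n
    · exact hk ▸ le_sup_left
    · exact (hS k).trans (le_sup_of_le_right (le_iSup₂_of_le k hk le_rfl))
  obtain ⟨y, hy, z, hz, rfl⟩ := Submodule.mem_sup.1 (hle hxS)
  have hz' : z ∈ A n := by simpa using sub_mem hx (hS n hy)
  rw [Submodule.disjoint_def.1 (hA n) z hz' hz, add_zero]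
  exact hy

namespace VOA

open VertexOperatorAlgebra

/-! ## The Virasoro action on the algebra -/

section Algebra

variable {V : Type*} [AddCommGroup V] [Module ℂ V] [VertexOperatorAlgebra V]

theorem mem_weightSpace_iff {v : V} {n : ℤ} : v ∈ weightSpace V n ↔ L 0 v = (n : ℂ) • v :=
  Module.End.mem_eigenspace_iff

theorem L_bracket (m n : ℤ) (v : V) :
    L m (L n v) = L n (L m v) + ((m : ℂ) - n) • L (m + n) v +
      (if m + n = 0 then ((m : ℂ) ^ 3 - m) / 12 * centralCharge V else 0) • v := by
  rw [add_assoc, ← sub_eq_iff_eq_add']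
  exact virasoro m n v

theorem L_mem_weightSpace {v : V} {n : ℤ} (hv : v ∈ weightSpace V n) (j : ℤ) :
    L j v ∈ weightSpace V (n - j) := by
  rw [mem_weightSpace_iff] at hv ⊢
  rw [L_bracket, hv]
  have : (if 0 + j = 0 then (((0 : ℤ) : ℂ) ^ 3 - (0 : ℤ)) / 12 * centralCharge V else 0) = 0 := by
    simp
  rw [this, zero_smul, add_zero, map_smul, zero_add, ← add_smul]
  push_cast
  congr 1
  ring

theorem weightSpace_eq_bot {n : ℤ} (hn : n < 0) : weightSpace V n = ⊥ := weight_neg n hn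

variable (V) in
theorem iSupIndep_weightSpace : iSupIndep (weightSpace V) :=
  (Module.End.eigenspaces_iSupIndep (L 0 : V →ₗ[ℂ] V)).comp Int.cast_injective

theorem omega_mem_weightSpace : (omega : V) ∈ weightSpace V 2 := by
  have h : (vacuum : V) ∈ weightSpace V 0 := by
    rw [mem_weightSpace_iff]
    simpa [L] using mode_vacuum (omega : V) 1 (by norm_num)
  have h2 := L_mem_weightSpace h (-2)
  have h3 : L (-2) (vacuum : V) = omega := creation (omega : V)
  simpa [h3] using h2

/-- `IsVirasoroWord v s x n`: the vector `x` of weight `n` is obtained from the vector `v` of weight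
`s` by applying operators `L_{-m}` with `m ≥ 1`. -/
inductive IsVirasoroWord (v : V) (s : ℤ) : V → ℤ → Prop
  | base : IsVirasoroWord v s v s
  | step {x : V} {n m : ℤ} : 1 ≤ m → IsVirasoroWord v s x n →
      IsVirasoroWord v s (L (-m) x) (n + m)

/-- The span of the Virasoro words of weight `n` in `v`. -/
def wordSpan (v : V) (s n : ℤ) : Submodule ℂ V := Submodule.span ℂ {x | IsVirasoroWord v s x n}

theorem IsVirasoroWord.mem_weightSpace {v x : V} {s n : ℤ} (hv : v ∈ weightSpace V s)
    (hx : IsVirasoroWord v s x n) : x ∈ weightSpace V n := by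
  induction hx with
  | base => exact hv
  | @step x n m _ _ ih =>
    rw [← sub_neg_eq_add]
    exact L_mem_weightSpace ih (-m)

theorem IsVirasoroWord.le {v x : V} {s n : ℤ} (hx : IsVirasoroWord v s x n) : s ≤ n := by
  induction hx with
  | base => exact le_rfl
  | step _ _ ih => omega

theorem wordSpan_le_weightSpace {v : V} {s : ℤ} (hv : v ∈ weightSpace V s) (n : ℤ) :
    wordSpan v s n ≤ weightSpace V n :=
  Submodule.span_le.2 fun _ hx => IsVirasoroWord.mem_weightSpace hv hx

theorem L_neg_mem_wordSpan {v x : V} {s n m : ℤ} (hm : 1 ≤ m) (hx : x ∈ wordSpan v s n) :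
    L (-m) x ∈ wordSpan v s (n + m) := by
  suffices wordSpan v s n ≤ (wordSpan v s (n + m)).comap (L (-m)) from this hx
  exact Submodule.span_le.2 fun y hy => Submodule.subset_span (IsVirasoroWord.step hm hy)

/-- No ordering of the words is needed: `L_j` is moved past the leftmost `L_{-m}`, and the induction
hypothesis, taken for all `j`, handles both `L_j x` and the bracket term `L_{j-m} x`. The central
term survives only for `j = m`, where the weights match. -/
theorem IsVirasoroWord.L_mem_wordSpan {v x : V} {s n : ℤ} (hv : IsHighestWeightVector v s)
    (hx : IsVirasoroWord v s x n) (j : ℤ) : L j x ∈ wordSpan v s (n - j) := by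
  induction hx generalizing j with
  | base =>
    rcases lt_trichotomy j 0 with hj | rfl | hj
    · have := L_neg_mem_wordSpan (m := -j) (by omega)
        (Submodule.subset_span (IsVirasoroWord.base (v := v) (s := s)))
      rwa [neg_neg, ← sub_eq_add_neg] at this
    · rw [mem_weightSpace_iff.1 hv.mem, sub_zero]
      exact Submodule.smul_mem _ _ (Submodule.subset_span IsVirasoroWord.base)
    · rw [hv.annihilated j hj]
      exact zero_mem _
  | @step x n m hm hx ih =>
    rw [L_bracket]
    refine add_mem (add_mem ?_ (Submodule.smul_mem _ _ ?_)) ?_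
    · convert L_neg_mem_wordSpan hm (ih j) using 2
      ring
    · convert ih (j + -m) using 2
      ring
    · split_ifs with h
      · refine Submodule.smul_mem _ _ (Submodule.subset_span ?_)
        have : n + m - j = n := by omega
        rw [this]
        exact hx
      · rw [zero_smul]
        exact zero_mem _

theorem L_mem_wordSpan {v x : V} {s n : ℤ} (hv : IsHighestWeightVector v s)
    (hx : x ∈ wordSpan v s n) (j : ℤ) : L j x ∈ wordSpan v s (n - j) := by
  suffices wordSpan v s n ≤ (wordSpan v s (n - j)).comap (L j) from this hx
  exact Submodule.span_le.2 fun y hy => IsVirasoroWord.L_mem_wordSpan hv hy j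

theorem virasoroSpan_le_iSup_wordSpan {v : V} {s : ℤ} (hv : IsHighestWeightVector v s) :
    virasoroSpan v ≤ ⨆ n, wordSpan v s n := by
  refine sInf_le ⟨le_iSup (wordSpan v s) s (Submodule.subset_span .base), fun j w hw => ?_⟩
  suffices ⨆ n, wordSpan v s n ≤ (⨆ n, wordSpan v s n).comap (L j) from this hw
  exact iSup_le fun n x hx => le_iSup (wordSpan v s) (n - j) (L_mem_wordSpan hv hx j)

end Algebra

/-! ### The projection `π` and the homogeneous parts of its kernel -/

namespace VirasoroDecomposition

variable {V : Type*} [AddCommGroup V] [Module ℂ V] [VertexOperatorAlgebra V] {ι : Type*}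
  (D : VirasoroDecomposition V ι)

theorem mem_iSup_wordSpan {n : ℤ} {x : V} (hx : x ∈ weightSpace V n) (hp : x ∈ D.positivePart) :
    x ∈ ⨆ i ∈ {i | 0 < D.wt i}, wordSpan (D.gen i) (D.wt i) n := by
  refine (iSupIndep_weightSpace V).mem_of_mem_iSup
    (S := fun n => ⨆ i ∈ {i | 0 < D.wt i}, wordSpan (D.gen i) (D.wt i) n)
    (fun k => iSup₂_le fun i _ => wordSpan_le_weightSpace (D.highestWeight i).mem k) hx ?_
  have : D.positivePart ≤
      ⨆ k : ℤ, ⨆ i ∈ {i | 0 < D.wt i}, wordSpan (D.gen i) (D.wt i) k := by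
    rw [positivePart_eq]
    refine iSup₂_le fun i hi => (virasoroSpan_le_iSup_wordSpan (D.highestWeight i)).trans ?_
    exact iSup_mono fun k => le_iSup₂_of_le
      (f := fun i (_ : i ∈ {i | 0 < D.wt i}) => wordSpan (D.gen i) (D.wt i) k) i hi le_rfl
  exact this hp

theorem proj_mem_Mbar (v : V) : D.proj v ∈ D.Mbar 0 := Submodule.projection_apply_mem _ v

theorem proj_eq_zero_iff {v : V} : D.proj v = 0 ↔ v ∈ D.positivePart :=
  Submodule.projection_apply_eq_zero_iff D.isCompl

theorem sub_proj_mem (v : V) : v - D.proj v ∈ D.positivePart := by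
  rw [← proj_eq_zero_iff, map_sub, sub_eq_zero]
  exact ((Submodule.projection_eq_self_iff D.isCompl _).2 (D.proj_mem_Mbar v)).symm

theorem proj_gen_eq_zero {i : ι} (hi : 0 < D.wt i) : D.proj (D.gen i) = 0 := by
  rw [proj_eq_zero_iff, positivePart_eq]
  refine (le_iSup₂_of_le (f := fun i (_ : i ∈ {i | 0 < D.wt i}) => virasoroSpan (D.gen i))
    i hi le_rfl) ?_
  rw [virasoroSpan, Submodule.mem_sInf]
  exact fun W hW => hW.1

/-- `π` commutes with the Virasoro operators. -/
theorem proj_L (n : ℤ) (v : V) : D.proj (L n v) = L n (D.proj v) := by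
  have h0 : L n (D.proj v) ∈ D.Mbar 0 := D.L_mem_iSup {i | D.wt i = 0} n (D.proj_mem_Mbar v)
  have h1 : L n (v - D.proj v) ∈ D.positivePart := by
    have h := D.sub_proj_mem v
    rw [positivePart_eq] at h ⊢
    exact D.L_mem_iSup _ n h
  rw [← proj_eq_zero_iff, map_sub, map_sub, sub_eq_zero] at h1
  rw [h1]
  exact (Submodule.projection_eq_self_iff D.isCompl _).2 h0

/-- The image under `π` of a highest weight vector is zero or a highest weight vector. -/
theorem isHighestWeightVector_proj {v : V} {s : ℤ} (hv : IsHighestWeightVector v s)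
    (h : D.proj v ≠ 0) : IsHighestWeightVector (D.proj v) s where
  ne_zero := h
  mem := D.proj_mem hv.mem
  annihilated n hn := by rw [← proj_L, hv.annihilated n hn, map_zero]

end VirasoroDecomposition

/-! ## Trace recursion on a module -/

section Modules

variable {V : Type*} (N : Type*) [AddCommGroup V] [Module ℂ V] [AddCommGroup N] [Module ℂ N]
  [VertexOperatorAlgebra V] [VOAModule V N]

/-- The mode `v_(n)` of `v ∈ V` on the module `N`. -/
def moduleMode (v : V) (n : ℤ) : Module.End ℂ N :=
  mode (VOAModule.Y : V →ₗ[ℂ] VertexOperator ℂ N) v n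

variable (V) in
/-- The Virasoro operator `L_n` on the module `N`. -/
def moduleL (n : ℤ) : Module.End ℂ N := moduleMode N (omega : V) (n + 1)

instance finiteDimensional_moduleWeightSpace (a : ℂ) :
    FiniteDimensional ℂ (moduleWeightSpace V N a) := VOAModule.finite_weight a

variable (V) in
/-- The linear functional `f ↦ tr|_{N_a} f`. -/
def gradedTrace (a : ℂ) : Module.End ℂ N →ₗ[ℂ] ℂ := (moduleWeightSpace V N a).compressionTrace

/-- The linear functional `v ↦ tr|_{N_a} v_(n-1)`, which extends `traceZeroMode` from `V_n`. -/
def traceFunctional (n : ℤ) (a : ℂ) : V →ₗ[ℂ] ℂ where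
  toFun v := gradedTrace V N a (moduleMode N v (n - 1))
  map_add' u v := by simp [moduleMode, mode]
  map_smul' c v := by simp [moduleMode, mode]

theorem traceZeroMode_eq (v : V) (n : ℤ) (hv : v ∈ weightSpace V n) (a : ℂ) :
    traceZeroMode N v n hv a = traceFunctional N n a v :=
  (Submodule.compressionTrace_eq_trace_restrict _).symm

variable {N}

theorem mem_moduleWeightSpace_iff {w : N} {a : ℂ} :
    w ∈ moduleWeightSpace V N a ↔ moduleL V N 0 w = a • w :=
  Module.End.mem_eigenspace_iff

theorem moduleMode_L_neg_one (v : V) (n : ℤ) :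
    moduleMode N (L (-1) v) n = (-n : ℂ) • moduleMode N v (n - 1) := by
  ext w
  rw [L_neg_one_eq]
  exact mode_mode_vacuum v n w

theorem moduleMode_smul (c : ℂ) (v : V) (n : ℤ) :
    moduleMode N (c • v) n = c • moduleMode N v n := by
  simp [moduleMode, mode]

/-- `v_(q)` with `v ∈ V_n` shifts degrees by `n - q - 1`. -/
theorem moduleMode_mem {v : V} {n : ℤ} (hv : v ∈ weightSpace V n) (q : ℤ) {a b : ℂ}
    (hab : b = a + n - q - 1) {w : N} (hw : w ∈ moduleWeightSpace V N a) :
    moduleMode N v q w ∈ moduleWeightSpace V N b := by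
  rw [mem_moduleWeightSpace_iff] at hw ⊢
  rw [mem_weightSpace_iff] at hv
  have h : moduleMode N (L (-1) v) (q + 1) w + moduleMode N (L 0 v) q w =
      moduleL V N 0 (moduleMode N v q w) - moduleMode N v q (moduleL V N 0 w) :=
    commutator_L_zero v q w
  rw [moduleMode_L_neg_one, hv, hw, moduleMode_smul, map_smul, eq_sub_iff_add_eq] at h
  rw [← h, hab, LinearMap.smul_apply, LinearMap.smul_apply, add_sub_cancel_right, ← add_smul,
    ← add_smul]
  push_cast
  congr 1
  ring

theorem moduleL_mem (k : ℤ) {a b : ℂ} (hab : b = a - k) {w : N}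
    (hw : w ∈ moduleWeightSpace V N a) : moduleL V N k w ∈ moduleWeightSpace V N b :=
  moduleMode_mem omega_mem_weightSpace (k + 1) (by rw [hab]; push_cast; ring) hw

variable (V N) in
theorem exists_moduleWeightSpace_sub_eq_bot (a : ℂ) :
    ∃ K : ℕ, ∀ k : ℕ, K ≤ k → moduleWeightSpace V N (a - k) = ⊥ := by
  obtain ⟨K, hK⟩ := VOAModule.lower_bound (V := V) (N := N) a
  refine ⟨(1 - K).toNat, fun k hk => ?_⟩
  have := hK (-k) (by omega)
  rw [Int.cast_neg, Int.cast_natCast, ← sub_eq_add_neg] at this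
  exact this

theorem gradedTrace_congr {a : ℂ} {f g : Module.End ℂ N}
    (h : ∀ w ∈ moduleWeightSpace V N a, f w = g w) : gradedTrace V N a f = gradedTrace V N a g :=
  Submodule.compressionTrace_congr h

theorem gradedTrace_mul_comm {a b : ℂ} {f g : Module.End ℂ N}
    (hf : ∀ w ∈ moduleWeightSpace V N a, f w ∈ moduleWeightSpace V N b)
    (hg : ∀ w ∈ moduleWeightSpace V N b, g w ∈ moduleWeightSpace V N a) :
    gradedTrace V N a (g * f) = gradedTrace V N b (f * g) :=
  Submodule.compressionTrace_mul_comm hf hg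

/-! ### Traces of products of a Virasoro operator and a mode -/

/-- The commutator formula `[L_k, u_(q)] = ∑ᵢ (k+1 choose i) (L_{i-1} u)_(k+1+q-i)`. -/
theorem moduleL_commutator {u : V} {n : ℤ} (hu : u ∈ weightSpace V n) (k q : ℤ) :
    moduleL V N k * moduleMode N u q - moduleMode N u q * moduleL V N k =
      ∑ i ∈ Finset.range (n + 2).toNat,
        Ring.choose (k + 1) i • moduleMode N (L ((i : ℤ) - 1) u) (k + 1 + q - i) := by
  ext w
  -- With `l = 0` the right side reduces to the commutator. On the left, `L_{i-1} u` has weight `n +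
  -- 1 - i`, which is negative for `i ≥ n + 2`.
  have h := VOAModule.jacobi (V := V) (N := N) omega u w 0 (k + 1) q
  rw [finsum_eq_sum_of_support_subset (s := Finset.range (n + 2).toNat),
    finsum_eq_single _ 0] at h
  · simp only [LinearMap.sub_apply, Module.End.mul_apply, LinearMap.sum_apply,
      LinearMap.smul_apply]
    simp only [pow_zero, Nat.cast_zero, Ring.choose_zero_right, mul_one, one_smul, zpow_zero,
      zero_add, sub_zero, add_zero] at h
    rw [moduleL, moduleMode, moduleMode, ← h]
    refine Finset.sum_congr rfl fun i _ => ?_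
    rw [L, sub_add_cancel]
    rfl
  · intro i hi
    simp [Ring.choose_zero_pos ℤ (Nat.pos_of_ne_zero hi)]
  · intro i hi
    by_contra hi'
    apply hi
    have h0 : L ((i : ℤ) - 1) u = 0 := by
      have := L_mem_weightSpace hu ((i : ℤ) - 1)
      rwa [weightSpace_eq_bot, Submodule.mem_bot] at this
      simp at hi'
      omega
    rw [L, sub_add_cancel] at h0
    simp only [zero_add, h0]
    simp [mode]

/-- Every term of the commutator formula is here a zero mode: `L_{i-1} u` has weight `n - i + 1`, so
its zero mode has index `n - i`. -/
theorem gradedTrace_commutator_eq_zero {u : V} {n : ℤ} (hu : u ∈ weightSpace V n) {a : ℂ}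
    (H : ∀ i : ℕ, gradedTrace V N a (moduleMode N (L ((i : ℤ) - 1) u) (n - i)) = 0) (k : ℤ) :
    gradedTrace V N a (moduleL V N k * moduleMode N u (n - 1 - k)) =
      gradedTrace V N a (moduleMode N u (n - 1 - k) * moduleL V N k) := by
  rw [← sub_eq_zero, ← map_sub, moduleL_commutator hu, map_sum]
  refine Finset.sum_eq_zero fun i _ => ?_
  rw [map_zsmul, show k + 1 + (n - 1 - k) - i = n - i by ring, H, smul_zero]

theorem gradedTrace_moduleL_mul_comm {u : V} {n : ℤ} (hu : u ∈ weightSpace V n) (k : ℤ)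
    {a b : ℂ} (hab : b = a + k) :
    gradedTrace V N a (moduleL V N k * moduleMode N u (n - 1 - k)) =
      gradedTrace V N b (moduleMode N u (n - 1 - k) * moduleL V N k) :=
  gradedTrace_mul_comm
    (fun _ hw => moduleMode_mem hu _ (by rw [hab]; push_cast; ring) hw)
    (fun _ hw => moduleL_mem k (by rw [hab]; ring) hw)

/-- If the zero modes of `u` and of all `L_{i-1} u` have trace zero in all degrees `≤ a`, then so
does `L_k u_(n-1-k)`. -/
theorem gradedTrace_moduleL_mul_eq_zero {u : V} {n : ℤ} (hu : u ∈ weightSpace V n) {a : ℂ}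
    (H : ∀ i j : ℕ, gradedTrace V N (a - j) (moduleMode N (L ((i : ℤ) - 1) u) (n - i)) = 0)
    (H0 : gradedTrace V N a (moduleMode N u (n - 1)) = 0) (k : ℤ) :
    gradedTrace V N a (moduleL V N k * moduleMode N u (n - 1 - k)) = 0 := by
  have hcomm := fun j : ℕ => gradedTrace_commutator_eq_zero hu (fun i => H i j) k
  rcases eq_or_ne k 0 with rfl | hk
  · have h0 := hcomm 0
    rw [Nat.cast_zero, sub_zero] at h0
    rw [h0, gradedTrace_congr (g := a • moduleMode N u (n - 1)), map_smul, H0, smul_zero]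
    intro w hw
    rw [Module.End.mul_apply, mem_moduleWeightSpace_iff.1 hw, map_smul, sub_zero,
      LinearMap.smul_apply]
  -- Cyclicity changes the degree and reverses the factors; the vanishing commutator restores their
  -- order. The latter is applied in the lower degree when `k < 0` and in the upper one when `k >
  -- 0`, so no degree above `a` is used.
  have hstep : ∀ j : ℕ,
      gradedTrace V N (a - j) (moduleL V N k * moduleMode N u (n - 1 - k)) =
        gradedTrace V N (a - (j + k.natAbs : ℕ))
          (moduleL V N k * moduleMode N u (n - 1 - k)) := by
    intro j
    rcases lt_or_gt_of_ne hk with hk' | hk'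
    · rw [hcomm (j + k.natAbs)]
      refine gradedTrace_moduleL_mul_comm hu k ?_
      have : (k : ℂ) = -(k.natAbs : ℂ) := by
        rw [← Int.cast_natCast, ← Int.cast_neg, show -(k.natAbs : ℤ) = k by omega]
      rw [this]
      push_cast
      ring
    · rw [hcomm j]
      refine (gradedTrace_moduleL_mul_comm hu k ?_).symm
      have : (k : ℂ) = (k.natAbs : ℂ) := by
        rw [← Int.cast_natCast, show (k.natAbs : ℤ) = k by omega]
      rw [this]
      push_cast
      ring
  have hiter : ∀ r : ℕ, gradedTrace V N a (moduleL V N k * moduleMode N u (n - 1 - k)) =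
      gradedTrace V N (a - (r * k.natAbs : ℕ))
        (moduleL V N k * moduleMode N u (n - 1 - k)) := by
    intro r
    induction r with
    | zero => simp
    | succ r ih => rw [ih, hstep, Nat.succ_mul]
  obtain ⟨K, hK⟩ := exists_moduleWeightSpace_sub_eq_bot V N a
  rw [hiter K, gradedTrace, hK _ (Nat.le_mul_of_pos_right K (Int.natAbs_pos.2 hk)),
    Submodule.compressionTrace_bot]

/-! ### Associativity and induction over descendants -/

/-- The associativity formula for `(L_{-m} u)_(p)`, on a fixed homogeneous subspace. -/
theorem exists_moduleMode_L_neg_eq {u : V} {n : ℤ} (hu : u ∈ weightSpace V n) (m : ℤ) (a : ℂ) :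
    ∃ K : ℕ, ∀ w ∈ moduleWeightSpace V N a, moduleMode N (L (-m) u) (n + m - 1) w =
      (∑ i ∈ Finset.range K, ((-1 : ℤ) ^ i * Ring.choose (1 - m) i) •
        (moduleL V N (-m - i) * moduleMode N u (n - 1 - (-m - i)) -
          (-1 : ℂ) ^ (1 - m) •
            (moduleMode N u (n - 1 - ((i : ℤ) - 1)) * moduleL V N ((i : ℤ) - 1)))) w := by
  obtain ⟨K, hK⟩ := exists_moduleWeightSpace_sub_eq_bot V N a
  -- For `i` at least this bound, `u_(n+m-1+i)` lowers degrees by `m + i ≥ K` and `L_{i-1}` by `i -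
  -- 1 ≥ K`, so both kill `w`.
  refine ⟨K + m.natAbs + 1, fun w hw => ?_⟩
  have h := VOAModule.jacobi (V := V) (N := N) omega u w (1 - m) 0 (n + m - 1)
  rw [finsum_eq_single _ 0,
    finsum_eq_sum_of_support_subset (s := Finset.range (K + m.natAbs + 1))] at h
  · simp only [Nat.cast_zero, Ring.choose_zero_right, one_smul, zero_add, sub_zero,
      add_zero] at h
    rw [LinearMap.sum_apply]
    rw [L, show -m + 1 = 1 - m by ring]
    refine h.trans (Finset.sum_congr rfl fun i _ => ?_)
    rw [LinearMap.smul_apply, LinearMap.sub_apply, LinearMap.smul_apply, Module.End.mul_apply,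
      Module.End.mul_apply, moduleL, moduleL, moduleMode, moduleMode, moduleMode, moduleMode,
      show 1 - m - i = -m - i + 1 by ring, show n + m - 1 + i = n - 1 - (-m - i) by ring,
      show 1 - m + (n + m - 1) - i = n - 1 - ((i : ℤ) - 1) by ring,
      show (i : ℤ) = i - 1 + 1 by ring]
    simp
  · intro i hi
    by_contra hi'
    apply hi
    simp only [Finset.coe_range, Set.mem_Iio, not_lt] at hi'
    have h1 : mode (VOAModule.Y : V →ₗ[ℂ] VertexOperator ℂ N) u (n + m - 1 + i) w = 0 := by
      have := moduleMode_mem hu (n + m - 1 + i) (b := a - ((m + i).toNat : ℕ)) (by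
        rw [← Int.cast_natCast (R := ℂ), Int.toNat_of_nonneg (by omega)]
        push_cast
        ring) hw
      rwa [hK _ (by omega), Submodule.mem_bot] at this
    have h2 : mode (VOAModule.Y : V →ₗ[ℂ] VertexOperator ℂ N) omega (0 + i) w = 0 := by
      have := moduleL_mem (V := V) ((i : ℤ) - 1) (b := a - ((i - 1 : ℕ) : ℂ)) (by
        rw [Nat.cast_sub (by omega)]
        push_cast
        ring) hw
      rw [hK _ (by omega), Submodule.mem_bot] at this
      rw [moduleL, sub_add_cancel] at this
      rw [zero_add]
      exact this
    simp only [h1, h2, map_zero, smul_zero, sub_zero]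
  · intro i hi
    simp [Ring.choose_zero_pos ℤ (Nat.pos_of_ne_zero hi)]

/-- If the zero modes of `u ∈ V_n` and of the `L_i u`, `i ≥ 0`, have trace zero in all degrees
`≤ a`, then so does the zero mode of `L_{-m} u`. -/
theorem traceFunctional_L_neg_eq_zero {u : V} {n : ℤ} (hu : u ∈ weightSpace V n) {a : ℂ}
    (H0 : ∀ j : ℕ, traceFunctional N n (a - j) u = 0)
    (H : ∀ i j : ℕ, traceFunctional N (n - i) (a - j) (L (i : ℤ) u) = 0) (m : ℤ) :
    traceFunctional N (n + m) a (L (-m) u) = 0 := by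
  have H' : ∀ i j : ℕ,
      gradedTrace V N (a - j) (moduleMode N (L ((i : ℤ) - 1) u) (n - i)) = 0 := by
    intro i j
    -- The term `i = 0` is the zero mode of `L_{-1} u`, a multiple of that of `u`; this keeps weight
    -- `n + 1` out of the hypotheses.
    cases i with
    | zero =>
      rw [Nat.cast_zero, zero_sub, sub_zero, moduleMode_L_neg_one, map_smul]
      exact smul_eq_zero_of_right _ (H0 j)
    | succ i =>
      have := H i j
      rw [Nat.cast_succ, add_sub_cancel_right, ← sub_sub]
      exact this
  have h0 : gradedTrace V N a (moduleMode N u (n - 1)) = 0 := by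
    have := H0 0
    rw [Nat.cast_zero, sub_zero] at this
    exact this
  have hL := gradedTrace_moduleL_mul_eq_zero hu H' h0
  have hR : ∀ k, gradedTrace V N a (moduleMode N u (n - 1 - k) * moduleL V N k) = 0 := fun k => by
    rw [← gradedTrace_commutator_eq_zero hu (fun i => by simpa using H' i 0), hL]
  obtain ⟨K, hK⟩ := exists_moduleMode_L_neg_eq (N := N) hu m a
  change gradedTrace V N a (moduleMode N (L (-m) u) (n + m - 1)) = 0
  rw [gradedTrace_congr hK, map_sum]
  refine Finset.sum_eq_zero fun i _ => ?_
  rw [map_zsmul, map_sub, map_smul, hL, hR, smul_zero, sub_zero, smul_zero]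

theorem traceFunctional_eq_zero_of_mem_wordSpan {v : V} {s : ℤ} (hv : IsHighestWeightVector v s)
    {a : ℂ} (H : ∀ j : ℕ, traceFunctional N s (a - j) v = 0) {n : ℤ} {x : V}
    (hx : x ∈ wordSpan v s n) (j : ℕ) : traceFunctional N n (a - j) x = 0 := by
  -- Strong induction on the weight, with `d` bounding the height above `s`. For a word `L_{-m} y`,
  -- both `y` and all `L_i y` with `i ≥ 0` lie strictly lower because `m ≥ 1`.
  obtain ⟨d, hd⟩ : ∃ d : ℕ, n < s + d := ⟨(n - s).toNat + 1, by omega⟩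
  induction d generalizing n x j with
  | zero =>
    have : wordSpan v s n = ⊥ := Submodule.span_eq_bot.2 fun y hy => by
      have := IsVirasoroWord.le hy
      simp at hd
      omega
    rw [this, Submodule.mem_bot] at hx
    rw [hx, map_zero]
  | succ d ih =>
    suffices wordSpan v s n ≤ LinearMap.ker (traceFunctional N n (a - j)) from this hx
    refine Submodule.span_le.2 fun y hy => ?_
    rw [SetLike.mem_coe, LinearMap.mem_ker]
    cases hy with
    | base => exact H j
    | @step y n m hm hy =>
      have hy' : y ∈ wordSpan v s n := Submodule.subset_span hy
      refine traceFunctional_L_neg_eq_zero (wordSpan_le_weightSpace hv.mem n hy')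
        (fun j' => ?_) (fun i j' => ?_) m
      · rw [sub_sub, ← Nat.cast_add]
        exact ih hy' _ (by push_cast at hd; omega)
      · rw [sub_sub, ← Nat.cast_add]
        exact ih (L_mem_wordSpan hv hy' i) _ (by push_cast at hd; omega)

/-! ### Reduction of the design condition to highest weight vectors -/

variable {ι : Type*} (D : VirasoroDecomposition V ι)

variable (N) in
/-- The design condition in all degrees `≤ h` only has to be checked on highest weight vectors in
the kernel of `π`. -/
theorem forall_isConformalDesign_iff (h : ℂ) (t : ℕ) :
    (∀ k : ℕ, IsConformalDesign N D t (h - k)) ↔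
      ∀ s : ℕ, 0 < s → s ≤ t → ∀ (v : V) (hv : IsHighestWeightVector v s), D.proj v = 0 →
        ∀ k : ℕ, traceZeroMode N v s hv.mem (h - k) = 0 := by
  simp only [IsConformalDesign, traceZeroMode_eq]
  constructor
  · intro H s _ hst v hv hπ k
    rw [H k s (by omega) (by omega) v hv.mem, hπ, map_zero]
  · intro H k n _ hnt v hv
    rw [← sub_eq_zero, ← map_sub]
    have hx := D.mem_iSup_wordSpan (sub_mem hv (D.proj_mem hv)) (D.sub_proj_mem v)
    suffices ⨆ i ∈ {i | 0 < D.wt i}, wordSpan (D.gen i) (D.wt i) n ≤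
        LinearMap.ker (traceFunctional N n (h - k)) from this hx
    refine iSup₂_le fun i hi x hx => ?_
    rw [LinearMap.mem_ker]
    by_cases hit : D.wt i ≤ t
    · exact traceFunctional_eq_zero_of_mem_wordSpan (D.highestWeight i)
        (H _ hi hit _ (D.highestWeight i) (D.proj_gen_eq_zero hi)) hx k
    -- A generator of weight above `t` has no descendants of weight `n ≤ t`.
    · have : wordSpan (D.gen i) (D.wt i) n = ⊥ := Submodule.span_eq_bot.2 fun y hy => by
        have := IsVirasoroWord.le hy
        omega
      rw [this, Submodule.mem_bot] at hx
      rw [hx, map_zero]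

end Modules

end VOA

end

theorem theorem2p3 {V N ι : Type*} [AddCommGroup V] [Module ℂ V] [AddCommGroup N] [Module ℂ N]
    [VertexOperatorAlgebra V] [VOAModule V N] (D : VOA.VirasoroDecomposition V ι)
    (h : ℂ) (hN : VOA.IsGradedBy V N h) (t : ℕ) (ht : 0 < t) :
    ((∀ k : ℕ, VOA.IsConformalDesign N D t (h - k)) ↔
      ∀ s : ℕ, 0 < s → s ≤ t →
        ∀ (v : V) (hv : VOA.IsHighestWeightVector v s), D.proj v = 0 →
          ∀ k : ℕ, VOA.traceZeroMode N v s hv.mem (h - k) = 0) ∧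
    ((∀ s : ℕ, 0 < s → s ≤ t → ∀ w ∈ D.Mbar 0, ¬ VOA.IsHighestWeightVector w s) →
      ((∀ k : ℕ, VOA.IsConformalDesign N D t (h - k)) ↔
        ∀ s : ℕ, 0 < s → s ≤ t →
          ∀ (v : V) (hv : VOA.IsHighestWeightVector v s),
            ∀ k : ℕ, VOA.traceZeroMode N v s hv.mem (h - k) = 0)) := by
  have key := VOA.forall_isConformalDesign_iff N D h t
  refine ⟨key, fun hω => ⟨fun H s hs hst v hv k => ?_, fun H => key.2 ?_⟩⟩
  · refine key.1 H s hs hst v hv ?_ k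
    -- Otherwise `π(v)` would be a highest weight vector of weight `s` in `V_ω`.
    by_contra hπ
    exact hω s hs hst _ (D.proj_mem_Mbar v) (D.isHighestWeightVector_proj hv hπ)
  · exact fun s hs hst v hv _ => H s hs hst v hv
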